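/- Let $A=(a_{ij}):\mathbb{R}^d\to\mathbb{R}^{d\times d}$ and $b=(b_i):\mathbb{R}^d\to\mathbb{R}^d$ be of class $C^2$ and $1$-periodic in each variable (that is, of class $C^2$ on the torus $\mathbb{T}^d$), and consider the operator in divergence form $$\mathcal{L}_{\mathrm{div}}w=-\sum_{i=1}^d\partial_{y_i}\big(b_iw\big)+\frac12\sum_{i,j=1}^d\partial^2_{y_iy_j}\big(a_{ij}w\big).$$ Assume that it is uniformly elliptic, i.e. there is $c_0>0$ with $\langle\xi,A(y)\xi\rangle\ge c_0\|\xi\|^2$ for all $y,\xi\in\mathbb{R}^d$, and that its zeroth-order coefficient satisfies $$\widetilde c(y):=\frac12\sum_{i,j=1}^d\partial^2_{y_iy_j}a_{ij}(y)-\sum_{i=1}^d\partial_{y_i}b_i(y)\le 0\qquad\text{for all }y\in\mathbb{T}^d.$$ Let $H^1(\mathbb{T}^d)$ be the closure of $C^\infty(\mathbb{T}^d)$ in the norm $\big(\|u\|_{L^2(\mathbb{T}^d)}^2+\|\nabla u\|_{L^2(\mathbb{T}^d)}^2\big)^{1/2}$. For $f\in L^2(\mathbb{T}^d)$, a function $w\in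 H^1(\mathbb{T}^d)$ is a weak solution of $-\mathcal{L}_{\mathrm{div}}w=f$ if $$\int_{\mathbb{T}^d}\Big(\tfrac12\langle A\nabla w,\nabla v\rangle+\langle\overline b,\nabla w\rangle v-\widetilde c\,wv\Big)\,dy=\int_{\mathbb{T}^d}fv\,dy\qquad\text{for all }v\in H^1(\mathbb{T}^d),$$ where $\overline b_i:=b_i-\frac12\sum_{j=1}^d\partial_{y_j}a_{ij}$. Then for every $f\in L^2(\mathbb{T}^d)$ with $\int_{\mathbb{T}^d}f\,dy=0$ there is exactly one $w\in H^1(\mathbb{T}^d)$ with $\int_{\mathbb{T}^d}w\,dy=0$ that is a weak solution of $-\mathcal{L}_{\mathrm{div}}w=f$. -/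

import Mathlib

open MeasureTheory
open scoped ContDiff

noncomputable section

namespace PeriodicElliptic

/-- A function on `ℝ^d` is periodic with respect to the unit cube if it is invariant under the
translations by integer multiples of the canonical basis vectors. -/
def IsPeriodic {d : ℕ} {E : Type*} (g : (Fin d → ℝ) → E) : Prop :=
  ∀ (y : Fin d → ℝ) (k : ℤ) (i : Fin d), g (y + Pi.single i (k : ℝ)) = g y

/-- The classical partial derivative `∂_{y_i} g`. -/
def pderiv {d : ℕ} (i : Fin d) (g : (Fin d → ℝ) → ℝ) (y : Fin d → ℝ) : ℝ :=
  fderiv ℝ g y (Pi.single i 1)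

/-- Lebesgue measure on the unit cube `[0,1]^d`, a fundamental domain of the torus `𝕋^d`.
Functions on the torus are identified with periodic functions on `ℝ^d`. -/
abbrev torusMeasure (d : ℕ) : Measure (Fin d → ℝ) :=
  volume.restrict (Set.Icc 0 1)

instance (d : ℕ) : IsFiniteMeasure (torusMeasure d) :=
  ⟨by simpa using (isCompact_Icc (a := (0 : Fin d → ℝ)) (b := 1)).measure_lt_top⟩

/-- The space `L²(𝕋^d)`. -/
abbrev L2Torus (d : ℕ) : Type := Lp ℝ 2 (torusMeasure d)

/-- The Hilbert space `L²(𝕋^d) × L²(𝕋^d)^d`, with norm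
`‖(u, g)‖² = ‖u‖² + ∑ i, ‖g i‖²`, in which `H¹(𝕋^d)` is realised by `u ↦ (u, ∇u)`. -/
abbrev L2Jet (d : ℕ) : Type :=
  WithLp 2 (L2Torus d × PiLp 2 (fun _ : Fin d => L2Torus d))

lemma integrable_L2 {d : ℕ} (u : L2Torus d) : Integrable u (torusMeasure d) :=
  (Lp.memLp u).integrable (by norm_num)

/-- The pairs `(φ, ∇φ)` with `φ ∈ C^∞(𝕋^d)`. -/
def smoothJets (d : ℕ) : Submodule ℝ (L2Jet d) where
  carrier := {U | ∃ φ : (Fin d → ℝ) → ℝ, ContDiff ℝ ∞ φ ∧ IsPeriodic φ ∧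
    U.fst =ᵐ[torusMeasure d] φ ∧ ∀ i, U.snd i =ᵐ[torusMeasure d] pderiv i φ}
  zero_mem' := by
    refine ⟨0, contDiff_const, fun _ _ _ => rfl, Lp.coeFn_zero _ _ _, fun i => ?_⟩
    have h : pderiv i (0 : (Fin d → ℝ) → ℝ) = 0 := by
      funext y; simp [pderiv]
    rw [h]; exact Lp.coeFn_zero _ _ _
  add_mem' := by
    rintro U V ⟨φ, hφ, pφ, uφ, gφ⟩ ⟨ψ, hψ, pψ, uψ, gψ⟩
    refine ⟨φ + ψ, hφ.add hψ, fun y k i => ?_, ?_, fun i => ?_⟩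
    · simp only [Pi.add_apply, pφ y k i, pψ y k i]
    · exact (Lp.coeFn_add _ _).trans (uφ.add uψ)
    · have h : pderiv i (φ + ψ) = pderiv i φ + pderiv i ψ := by
        funext y
        have h1 := (hφ.differentiable (by simp)) y
        have h2 := (hψ.differentiable (by simp)) y
        simp [pderiv, fderiv_add h1 h2]
      rw [h]; exact (Lp.coeFn_add _ _).trans ((gφ i).add (gψ i))
  smul_mem' := by
    rintro c U ⟨φ, hφ, pφ, uφ, gφ⟩
    refine ⟨c • φ, hφ.const_smul c, fun y k i => ?_, ?_, fun i => ?_⟩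
    · simp only [Pi.smul_apply, pφ y k i]
    · exact (Lp.coeFn_smul _ _).trans (uφ.const_smul c)
    · have h : pderiv i (c • φ) = c • pderiv i φ := by
        funext y
        have h1 := (hφ.differentiable (by simp)) y
        simp [pderiv, fderiv_const_smul h1]
      rw [h]; exact (Lp.coeFn_smul _ _).trans ((gφ i).const_smul c)

/-- The Sobolev space `H¹(𝕋^d)`: the closure of `C^∞(𝕋^d)` for the norm
`(‖u‖²_{L²} + ‖∇u‖²_{L²})^{1/2}`. An element is recorded together with its weak gradient. -/
def H1Torus (d : ℕ) : Submodule ℝ (L2Jet d) := (smoothJets d).topologicalClosure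

/-- The function underlying an element of `H¹(𝕋^d)`. -/
def toFun {d : ℕ} (u : H1Torus d) : L2Torus d := (u : L2Jet d).fst

/-- The weak partial derivative `∂_{y_i} u` of an element of `H¹(𝕋^d)`. -/
def grad {d : ℕ} (u : H1Torus d) (i : Fin d) : L2Torus d := (u : L2Jet d).snd i

/-- The mean-zero functions in `L²(𝕋^d)`. -/
def meanZeroL2 (d : ℕ) : Submodule ℝ (L2Torus d) where
  carrier := {u | ∫ y, u y ∂(torusMeasure d) = 0}
  zero_mem' := by
    change ∫ y, (0 : L2Torus d) y ∂(torusMeasure d) = 0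
    rw [integral_congr_ae (Lp.coeFn_zero ℝ 2 (torusMeasure d))]; simp
  add_mem' := by
    intro u v (hu : ∫ y, u y ∂(torusMeasure d) = 0) (hv : ∫ y, v y ∂(torusMeasure d) = 0)
    change ∫ y, (u + v : L2Torus d) y ∂(torusMeasure d) = 0
    rw [integral_congr_ae (Lp.coeFn_add u v)]
    simp only [Pi.add_apply]
    rw [integral_add (integrable_L2 u) (integrable_L2 v), hu, hv, add_zero]
  smul_mem' := by
    intro c u (hu : ∫ y, u y ∂(torusMeasure d) = 0)
    change ∫ y, (c • u : L2Torus d) y ∂(torusMeasure d) = 0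
    rw [integral_congr_ae (Lp.coeFn_smul c u)]
    simp only [Pi.smul_apply, smul_eq_mul]
    rw [integral_const_mul, hu, mul_zero]

/-- The mean-zero functions in `H¹(𝕋^d)`. -/
def meanZeroH1 (d : ℕ) : Set (H1Torus d) := {u | toFun u ∈ meanZeroL2 d}

/-- Uniform ellipticity of the operator with second-order coefficients `A`. -/
def IsUniformlyElliptic {d : ℕ} (A : (Fin d → ℝ) → Matrix (Fin d) (Fin d) ℝ) : Prop :=
  ∃ c₀ : ℝ, 0 < c₀ ∧ ∀ y ξ : Fin d → ℝ, c₀ * ∑ i, ξ i ^ 2 ≤ ∑ i, ∑ j, ξ i * A y i j * ξ j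

section Operator

/-! The divergence-form operator with coefficients `A`, `b` is
`L_div w = - ∑ i, ∂_i (b_i w) + 1/2 ∑ i j, ∂_i ∂_j (a_ij w)`. -/

variable {d : ℕ} (A : (Fin d → ℝ) → Matrix (Fin d) (Fin d) ℝ) (b : (Fin d → ℝ) → Fin d → ℝ)

/-- The coefficient `b̃_i = ∑ j, ∂_j a_ij - b_i`: for symmetric `A`, the first-order coefficient
of `L_div` in non-divergence form. -/
def bTilde (i : Fin d) (y : Fin d → ℝ) : ℝ :=
  ∑ j, pderiv j (fun z => A z i j) y - b y i

/-- Zeroth-order coefficient of `L_div` in non-divergence form: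
`c̃ = 1/2 ∑ i j, ∂_i ∂_j a_ij - ∑ i, ∂_i b_i`. -/
def cTilde (y : Fin d → ℝ) : ℝ :=
  1 / 2 * ∑ i, ∑ j, pderiv i (pderiv j (fun z => A z i j)) y - ∑ i, pderiv i (fun z => b z i) y

/-- First-order coefficient of the bilinear form: `b̄_i = 1/2 ∑ j, ∂_j a_ij - b̃_i`. -/
def bBar (i : Fin d) (y : Fin d → ℝ) : ℝ :=
  1 / 2 * ∑ j, pderiv j (fun z => A z i j) y - bTilde A b i y

/-- The bilinear form on `H¹(𝕋^d)` associated with `-L_div` by integration by parts: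
`a(u, v) = ∫ (1/2 ⟨A ∇u, ∇v⟩ + ⟨b̄, ∇u⟩ v - c̃ u v)`. -/
def bilinForm (u v : H1Torus d) : ℝ :=
  ∫ y, (1 / 2 * ∑ i, ∑ j, A y i j * grad u j y * grad v i y
    + (∑ i, bBar A b i y * grad u i y) * toFun v y
    + (-cTilde A b y) * toFun u y * toFun v y) ∂(torusMeasure d)

/-- `w ∈ H¹(𝕋^d)` is a weak solution of `-L_div w = f`. -/
def IsWeakSolution (f : L2Torus d) (w : H1Torus d) : Prop :=
  ∀ v : H1Torus d, bilinForm A b w v = ∫ y, f y * toFun v y ∂(torusMeasure d)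

end Operator

end PeriodicElliptic

end

/-!
The zeroth-order coefficient `c̃` is minus the divergence of the periodic drift `b̄`, so its integral
over the torus is zero (`integral_sum_pderiv_eq_zero`). Having constant sign, it vanishes almost
everywhere (`cTilde_ae_eq_zero`), and `b̄` is therefore divergence-free. This has two consequences.

* `⟨b̄, ∇u⟩ u = ⟨b̄, ∇(u² / 2)⟩` integrates to zero (`integral_drift_self`), so that
  `a(u, u) = 1/2 ∫ ⟨A ∇u, ∇u⟩ ≥ c₀/2 ‖∇u‖²`. With the Poincaré inequality (`norm_sq_toFun_le`), the
  form is coercive on the mean-zero part of `H¹` (`exists_pos_le_bilinForm_self`), and the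
  Lax-Milgram theorem solves the equation there, uniquely. No compactness argument is needed.
* `a(w, 1) = ∫ ⟨b̄, ∇w⟩ = 0` for every `w` (`bilinForm_eq_zero_of_const`). As also `∫ f = 0`, a
  solution tested against mean-zero functions is a solution tested against all of `H¹`.

The Poincaré inequality is proved for smooth periodic `φ` and extended by density. For `h` in the
unit cube, `‖φ(· + h) - φ‖² ≤ d ‖∇φ‖²` by integrating along segments, and averaging the left-hand
side over `h` gives `2 ‖φ‖² - 2 (∫ φ)²`.
-/

open MeasureTheory
open scoped ContDiff

noncomputable section

namespace PeriodicElliptic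

variable {d : ℕ}

/-! ### Periodic functions and partial derivatives -/

lemma IsPeriodic.pderiv {g : (Fin d → ℝ) → ℝ} (hg : IsPeriodic g) (i : Fin d) :
    IsPeriodic (pderiv i g) := by
  intro y k j
  have h : (fun z => g (z + Pi.single j (k : ℝ))) = g := funext fun z => hg z k j
  unfold PeriodicElliptic.pderiv
  conv_rhs => rw [← h]
  rw [fderiv_comp_add_right]

lemma IsPeriodic.comp_add_right {g : (Fin d → ℝ) → ℝ} (hg : IsPeriodic g) (h : Fin d → ℝ) :
    IsPeriodic fun y => g (y + h) := by
  intro y k i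
  have := hg (y + h) k i
  rwa [add_right_comm] at this

lemma contDiff_pderiv {g : (Fin d → ℝ) → ℝ} {m n : WithTop ℕ∞} (hg : ContDiff ℝ n g)
    (hmn : m + 1 ≤ n) (i : Fin d) : ContDiff ℝ m (pderiv i g) :=
  (hg.fderiv_right hmn).clm_apply contDiff_const

lemma continuous_pderiv {g : (Fin d → ℝ) → ℝ} (hg : ContDiff ℝ 1 g) (i : Fin d) :
    Continuous (pderiv i g) :=
  (contDiff_pderiv (m := 0) hg (by simp) i).continuous

lemma fderiv_apply_eq_sum_pderiv (g : (Fin d → ℝ) → ℝ) (x h : Fin d → ℝ) :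
    fderiv ℝ g x h = ∑ i, h i * pderiv i g x := by
  conv_lhs => rw [← Finset.univ_sum_single h, map_sum]
  refine Finset.sum_congr rfl fun i _ => ?_
  have : (Pi.single i (h i) : Fin d → ℝ) = h i • Pi.single i 1 := by
    rw [← Pi.single_smul]; simp
  rw [this, map_smul, smul_eq_mul, pderiv]

lemma pderiv_comp_add_right (i : Fin d) (g : (Fin d → ℝ) → ℝ) (h y : Fin d → ℝ) :
    pderiv i (fun z => g (z + h)) y = pderiv i g (y + h) := by
  simp only [pderiv]
  rw [fderiv_comp_add_right]

lemma pderiv_const_mul (i : Fin d) {g : (Fin d → ℝ) → ℝ} {y : Fin d → ℝ} (c : ℝ)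
    (hg : DifferentiableAt ℝ g y) : pderiv i (fun z => c * g z) y = c * pderiv i g y := by
  simp [pderiv, fderiv_const_mul hg]

lemma pderiv_mul (i : Fin d) {g h : (Fin d → ℝ) → ℝ} {y : Fin d → ℝ}
    (hg : DifferentiableAt ℝ g y) (hh : DifferentiableAt ℝ h y) :
    pderiv i (fun z => g z * h z) y = g y * pderiv i h y + h y * pderiv i g y := by
  simp [pderiv, fderiv_fun_mul hg hh]

/-! ### Integration over the unit cube -/

lemma isCompact_cube : IsCompact (Set.Icc (0 : Fin d → ℝ) 1) := isCompact_Icc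

instance : IsProbabilityMeasure (torusMeasure d) :=
  ⟨by simp [torusMeasure, Real.volume_Icc_pi]⟩

lemma integrable_torus {g : (Fin d → ℝ) → ℝ} (hg : Continuous g) :
    Integrable g (torusMeasure d) :=
  hg.continuousOn.integrableOn_compact isCompact_cube

lemma setIntegral_swap_of_continuous {E F : Type*} [TopologicalSpace E] [T2Space E]
    [SecondCountableTopology E] [MeasurableSpace E] [BorelSpace E]
    [TopologicalSpace F] [T2Space F] [SecondCountableTopology F] [MeasurableSpace F] [BorelSpace F]
    {μ : Measure E} {ν : Measure F} [IsFiniteMeasureOnCompacts μ] [IsFiniteMeasureOnCompacts ν]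
    [SFinite μ] [SFinite ν] {K : Set E} {L : Set F} (hK : IsCompact K) (hL : IsCompact L)
    {f : E → F → ℝ} (hf : Continuous (Function.uncurry f)) :
    ∫ x in K, ∫ y in L, f x y ∂ν ∂μ = ∫ y in L, ∫ x in K, f x y ∂μ ∂ν := by
  refine integral_integral_swap ?_
  rw [Measure.prod_restrict]
  have h1 : (μ.prod ν) (K ×ˢ L) ≠ ⊤ := by
    rw [Measure.prod_prod]
    exact ENNReal.mul_ne_top hK.measure_ne_top hL.measure_ne_top
  exact hf.continuousOn.integrableOn_of_subset_isCompact (hK.prod hL)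
    (hK.measurableSet.prod hL.measurableSet) subset_rfl h1

/-- The divergence theorem on the torus: opposite faces of the cube cancel by periodicity. -/
theorem integral_sum_pderiv_eq_zero {F : Fin d → (Fin d → ℝ) → ℝ}
    (hF : ∀ i, ContDiff ℝ 1 (F i)) (pF : ∀ i, IsPeriodic (F i)) :
    ∫ y, ∑ i, pderiv i (F i) y ∂(torusMeasure d) = 0 := by
  cases d with
  | zero => simp
  | succ n =>
    have key := integral_divergence_of_hasFDerivAt_off_countable' (0 : Fin (n + 1) → ℝ) 1
      zero_le_one F (fun i => fderiv ℝ (F i)) ∅ Set.countable_empty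
      (fun i => (hF i).continuous.continuousOn)
      (fun x _ i => ((hF i).differentiable (by simp) x).hasFDerivAt)
      (integrable_torus (continuous_finsetSum _ fun i _ => continuous_pderiv (hF i) i))
    refine key.trans (Finset.sum_eq_zero fun i _ => sub_eq_zero.2 ?_)
    refine integral_congr_ae (.of_forall fun x => ?_)
    have h := pF i (i.insertNth 0 x) 1 i
    -- The two faces orthogonal to the `i`-th direction differ by a unit translation.
    have e : (i.insertNth (0 : ℝ) x : Fin (n + 1) → ℝ) + Pi.single i ((1 : ℤ) : ℝ)
        = i.insertNth (1 : ℝ) x := by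
      ext j
      refine Fin.succAboveCases i ?_ (fun k => ?_) j
      · simp
      · simp [Fin.succAbove_ne]
    rw [e] at h
    simpa using h

lemma sub_eq_setIntegral_sum_pderiv {g : (Fin d → ℝ) → ℝ} (hg : ContDiff ℝ 1 g)
    (h y : Fin d → ℝ) :
    g (y + h) - g y = ∫ t in Set.Icc (0 : ℝ) 1, ∑ i, h i * pderiv i g (y + t • h) := by
  rw [integral_Icc_eq_integral_Ioc, ← intervalIntegral.integral_of_le zero_le_one,
    intervalIntegral.integral_eq_sub_of_hasDerivAt (f := fun t : ℝ => g (y + t • h))]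
  · simp
  · intro t _
    rw [← fderiv_apply_eq_sum_pderiv]
    have h1 : HasDerivAt (fun t : ℝ => y + t • h) h t := by
      simpa using ((hasDerivAt_id t).smul_const h).const_add y
    exact ((hg.differentiable (by simp) _).hasFDerivAt).comp_hasDerivAt t h1
  · refine Continuous.intervalIntegrable ?_ _ _
    exact continuous_finsetSum _ fun i _ => continuous_const.mul
      ((continuous_pderiv hg i).comp (by fun_prop))

/-- Translation invariance of the integral over the torus. The derivative of a translate in the
direction of the translation is a divergence. -/
theorem integral_comp_add_right {g : (Fin d → ℝ) → ℝ} (hg : ContDiff ℝ 1 g) (pg : IsPeriodic g)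
    (h : Fin d → ℝ) :
    ∫ y, g (y + h) ∂(torusMeasure d) = ∫ y, g y ∂(torusMeasure d) := by
  have hc := hg.continuous
  rw [← sub_eq_zero, ← integral_sub (integrable_torus (by fun_prop)) (integrable_torus hc)]
  simp_rw [sub_eq_setIntegral_sum_pderiv hg h]
  rw [setIntegral_swap_of_continuous isCompact_cube isCompact_Icc]
  · refine integral_eq_zero_of_ae (.of_forall fun t => ?_)
    have hF : ∀ i : Fin d, ContDiff ℝ 1 fun y => h i * g (y + t • h) := fun i => by fun_prop
    have hdiv := integral_sum_pderiv_eq_zero hF fun i y k j => by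
      simp only [pg.comp_add_right (t • h) y k j]
    rw [Pi.zero_apply, ← hdiv]
    refine integral_congr_ae (.of_forall fun y => Finset.sum_congr rfl fun i _ => ?_)
    rw [pderiv_const_mul, pderiv_comp_add_right]
    exact (hg.differentiable (by simp)).comp (by fun_prop) _
  · exact continuous_finsetSum _ fun i _ => continuous_const.mul
      ((continuous_pderiv hg i).comp (by fun_prop))

/-! ### The Poincaré inequality on the torus -/

lemma sq_setIntegral_Icc_le {g : ℝ → ℝ} (hg : Continuous g) :
    (∫ t in Set.Icc (0 : ℝ) 1, g t) ^ 2 ≤ ∫ t in Set.Icc (0 : ℝ) 1, g t ^ 2 := by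
  have : IsProbabilityMeasure (volume.restrict (Set.Icc (0 : ℝ) 1)) := ⟨by simp⟩
  exact (even_two.convexOn_pow (𝕜 := ℝ)).map_integral_le (by fun_prop) isClosed_univ
    (by simp) (hg.continuousOn.integrableOn_compact isCompact_Icc)
    ((hg.pow 2).continuousOn.integrableOn_compact isCompact_Icc)

/-- The increment along `h` is the integral of `⟨h, ∇φ⟩` over a segment; Cauchy-Schwarz with
`∑ i, h i ^ 2 ≤ d` and translation invariance bound its square. -/
lemma integral_sq_translate_sub_le {φ : (Fin d → ℝ) → ℝ} (hφ : ContDiff ℝ 2 φ)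
    (pφ : IsPeriodic φ) {h : Fin d → ℝ} (hh : h ∈ Set.Icc (0 : Fin d → ℝ) 1) :
    ∫ y, (φ (y + h) - φ y) ^ 2 ∂(torusMeasure d)
      ≤ d * ∫ y, ∑ i, pderiv i φ y ^ 2 ∂(torusMeasure d) := by
  have hφ1 : ContDiff ℝ 1 φ := hφ.of_le (by norm_num)
  have hc := hφ.continuous
  have hp : ∀ i, Continuous (pderiv i φ) := continuous_pderiv hφ1
  have hG : Continuous (Function.uncurry fun (y : Fin d → ℝ) (t : ℝ) =>
      (∑ i, h i * pderiv i φ (y + t • h)) ^ 2) :=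
    (continuous_finsetSum _ fun i _ => continuous_const.mul
      ((hp i).comp (by fun_prop))).pow 2
  have hsq : ContDiff ℝ 1 fun y => ∑ i, pderiv i φ y ^ 2 :=
    ContDiff.sum fun i _ => (contDiff_pderiv hφ (by norm_num) i).pow 2
  have psq : IsPeriodic fun y => ∑ i, pderiv i φ y ^ 2 := fun y k j => by
    simp only [pφ.pderiv _ y k j]
  have hh2 : ∑ i, h i ^ 2 ≤ d := by
    calc ∑ i, h i ^ 2 ≤ ∑ _i : Fin d, (1 : ℝ) :=
          Finset.sum_le_sum fun i _ => pow_le_one₀ (hh.1 i) (hh.2 i)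
      _ = d := by simp
  calc ∫ y, (φ (y + h) - φ y) ^ 2 ∂(torusMeasure d)
      ≤ ∫ y, (∫ t in Set.Icc (0 : ℝ) 1, (∑ i, h i * pderiv i φ (y + t • h)) ^ 2)
          ∂(torusMeasure d) := by
        refine integral_mono (integrable_torus (by fun_prop)) (integrable_torus
          (continuous_parametric_integral_of_continuous hG isCompact_Icc)) fun y => ?_
        rw [sub_eq_setIntegral_sum_pderiv hφ1 h]
        exact sq_setIntegral_Icc_le (continuous_finsetSum _ fun i _ => continuous_const.mul
          ((hp i).comp (by fun_prop)))
    _ = ∫ t in Set.Icc (0 : ℝ) 1, ∫ y, (∑ i, h i * pderiv i φ (y + t • h)) ^ 2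
          ∂(torusMeasure d) :=
        setIntegral_swap_of_continuous isCompact_cube isCompact_Icc hG
    _ ≤ ∫ t in Set.Icc (0 : ℝ) 1, d * ∫ y, ∑ i, pderiv i φ y ^ 2 ∂(torusMeasure d) := by
        refine integral_mono ?_ (integrable_const _) fun t => ?_
        · refine (Continuous.continuousOn ?_).integrableOn_compact isCompact_Icc
          exact continuous_parametric_integral_of_continuous
            (f := fun t y => (∑ i, h i * pderiv i φ (y + t • h)) ^ 2)
            (hG.comp continuous_swap) isCompact_cube
        · change _ ≤ d * ∫ y, ∑ i, pderiv i φ y ^ 2 ∂(torusMeasure d)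
          rw [← integral_comp_add_right hsq psq (t • h), ← integral_const_mul]
          refine integral_mono (integrable_torus (hG.comp (by fun_prop : Continuous
            fun y : Fin d → ℝ => (y, t)))) (integrable_torus ?_) fun y => ?_
          · exact continuous_const.mul (hsq.continuous.comp (by fun_prop))
          · exact (Finset.sum_mul_sq_le_sq_mul_sq _ _ _).trans
              (mul_le_mul_of_nonneg_right hh2 (Finset.sum_nonneg fun i _ => sq_nonneg _))
    _ = _ := by simp

/-- The Poincaré inequality for smooth periodic functions, obtained by averaging
`‖φ(· + h) - φ‖²` over all translations `h` in the unit cube. -/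
theorem integral_sq_le_of_contDiff {φ : (Fin d → ℝ) → ℝ} (hφ : ContDiff ℝ 2 φ)
    (pφ : IsPeriodic φ) :
    ∫ y, φ y ^ 2 ∂(torusMeasure d) ≤ (∫ y, φ y ∂(torusMeasure d)) ^ 2
      + d / 2 * ∫ y, ∑ i, pderiv i φ y ^ 2 ∂(torusMeasure d) := by
  have hφ1 : ContDiff ℝ 1 φ := hφ.of_le (by norm_num)
  have hc := hφ.continuous
  set S := ∫ y, φ y ^ 2 ∂(torusMeasure d)
  set m := ∫ y, φ y ∂(torusMeasure d)
  have expand : ∀ h : Fin d → ℝ, ∫ y, (φ (y + h) - φ y) ^ 2 ∂(torusMeasure d)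
      = 2 * S - 2 * ∫ y, φ y * φ (y + h) ∂(torusMeasure d) := by
    intro h
    have e : ∀ y, (φ (y + h) - φ y) ^ 2 = (φ (y + h) ^ 2 + φ y ^ 2) - 2 * (φ y * φ (y + h)) :=
      fun y => by ring
    have ht : ∫ y, φ (y + h) ^ 2 ∂(torusMeasure d) = S :=
      integral_comp_add_right (hφ1.pow 2) (fun y k i => by simp only [pφ y k i]) h
    simp_rw [e]
    rw [integral_sub (integrable_torus (by fun_prop)) (integrable_torus (by fun_prop)),
      integral_add (integrable_torus (by fun_prop)) (integrable_torus (by fun_prop)),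
      integral_const_mul, ht]
    ring
  have hcorr : Continuous fun h : Fin d → ℝ => ∫ y, φ y * φ (y + h) ∂(torusMeasure d) :=
    continuous_parametric_integral_of_continuous (by fun_prop) isCompact_cube
  -- The average of the autocorrelation of `φ` over all translations is the square of its mean.
  have avg : ∫ h, ∫ y, φ y * φ (y + h) ∂(torusMeasure d) ∂(torusMeasure d) = m ^ 2 := by
    rw [setIntegral_swap_of_continuous isCompact_cube isCompact_cube (by fun_prop)]
    have e : ∀ y, ∫ h, φ y * φ (y + h) ∂(torusMeasure d) = φ y * m := fun y => by
      rw [integral_const_mul]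
      simp_rw [add_comm y]
      rw [integral_comp_add_right hφ1 pφ]
    simp_rw [e]
    rw [integral_mul_const, sq]
  have le : ∫ h, (2 * S - 2 * ∫ y, φ y * φ (y + h) ∂(torusMeasure d)) ∂(torusMeasure d)
      ≤ ∫ _h, d * ∫ y, ∑ i, pderiv i φ y ^ 2 ∂(torusMeasure d) ∂(torusMeasure d) := by
    refine setIntegral_mono_on (integrable_torus (by fun_prop)) (integrable_torus (by fun_prop))
      isCompact_cube.measurableSet fun h hh => ?_
    rw [← expand]
    exact integral_sq_translate_sub_le hφ pφ hh
  rw [integral_sub (integrable_torus (by fun_prop)) (integrable_torus (by fun_prop)),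
    integral_const_mul, integral_const_mul, avg] at le
  simp only [integral_const, probReal_univ, one_smul] at le
  linarith

/-! ### The coefficients of the operator -/

section Coefficients

variable {A : (Fin d → ℝ) → Matrix (Fin d) (Fin d) ℝ} {b : (Fin d → ℝ) → Fin d → ℝ}

lemma bBar_eq (i : Fin d) :
    bBar A b i = fun y => b y i - 1 / 2 * ∑ j, pderiv j (fun z => A z i j) y := by
  funext y
  simp only [bBar, bTilde]
  ring

lemma contDiff_bBar (hA : ∀ i j, ContDiff ℝ 2 fun y => A y i j)
    (hb : ∀ i, ContDiff ℝ 2 fun y => b y i) (i : Fin d) : ContDiff ℝ 1 (bBar A b i) := by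
  rw [bBar_eq]
  exact ((hb i).of_le (by norm_num)).sub
    (contDiff_const.mul (ContDiff.sum fun j _ => contDiff_pderiv (hA i j) (by norm_num) j))

lemma isPeriodic_bBar (pA : IsPeriodic A) (pb : IsPeriodic b) (i : Fin d) :
    IsPeriodic (bBar A b i) := by
  intro y k l
  have h : ∀ j, IsPeriodic fun z => A z i j := fun j y k l => by simp only [pA y k l]
  simp only [bBar_eq, pb y k l, (h _).pderiv _ y k l]

lemma continuous_cTilde (hA : ∀ i j, ContDiff ℝ 2 fun y => A y i j)
    (hb : ∀ i, ContDiff ℝ 2 fun y => b y i) : Continuous (cTilde A b) := by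
  refine (continuous_const.mul (continuous_finsetSum _ fun i _ =>
    continuous_finsetSum _ fun j _ => ?_)).sub (continuous_finsetSum _ fun i _ => ?_)
  · exact continuous_pderiv (contDiff_pderiv (hA i j) (by norm_num) j) i
  · exact continuous_pderiv ((hb i).of_le (by norm_num)) i

/-- The zeroth-order coefficient is minus the divergence of the drift of the bilinear form. -/
lemma sum_pderiv_bBar (hA : ∀ i j, ContDiff ℝ 2 fun y => A y i j)
    (hb : ∀ i, ContDiff ℝ 2 fun y => b y i) (y : Fin d → ℝ) :
    ∑ i, pderiv i (bBar A b i) y = -cTilde A b y := by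
  have hdA : ∀ i j, DifferentiableAt ℝ (pderiv j fun z => A z i j) y := fun i j =>
    (contDiff_pderiv (m := 1) (hA i j) (by norm_num) j).differentiable (by simp) y
  have hdb : ∀ i, DifferentiableAt ℝ (fun z => b z i) y := fun i =>
    (hb i).differentiable (by simp) y
  have h : ∀ i, pderiv i (bBar A b i) y = pderiv i (fun z => b z i) y
      - 1 / 2 * ∑ j, pderiv i (pderiv j fun z => A z i j) y := fun i => by
    rw [bBar_eq]
    have hs : DifferentiableAt ℝ (fun z => ∑ j, pderiv j (fun z => A z i j) z) y :=
      DifferentiableAt.fun_sum fun j _ => hdA i j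
    rw [pderiv, fderiv_fun_sub (hdb i) (hs.const_mul _), fderiv_const_mul hs,
      fderiv_fun_sum fun j _ => hdA i j]
    simp [pderiv]
  simp_rw [h]
  rw [Finset.sum_sub_distrib, ← Finset.mul_sum, cTilde]
  ring

/-- A divergence has mean zero on the torus, so a zeroth-order coefficient of constant sign
vanishes. -/
theorem cTilde_ae_eq_zero (hA : ∀ i j, ContDiff ℝ 2 fun y => A y i j)
    (hb : ∀ i, ContDiff ℝ 2 fun y => b y i) (pA : IsPeriodic A) (pb : IsPeriodic b)
    (hc : ∀ y, cTilde A b y ≤ 0) : cTilde A b =ᵐ[torusMeasure d] 0 := by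
  have h0 := integral_sum_pderiv_eq_zero (contDiff_bBar hA hb) (isPeriodic_bBar pA pb)
  simp_rw [sum_pderiv_bBar hA hb] at h0
  rw [integral_eq_zero_iff_of_nonneg (fun y => neg_nonneg.2 (hc y))
    (integrable_torus (continuous_cTilde hA hb).neg)] at h0
  filter_upwards [h0] with y hy
  simpa using hy

/-- The drift of the bilinear form is divergence-free, hence orthogonal to gradients. -/
theorem integral_sum_bBar_mul_pderiv (hA : ∀ i j, ContDiff ℝ 2 fun y => A y i j)
    (hb : ∀ i, ContDiff ℝ 2 fun y => b y i) (pA : IsPeriodic A) (pb : IsPeriodic b)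
    (hc : ∀ y, cTilde A b y ≤ 0) {ψ : (Fin d → ℝ) → ℝ} (hψ : ContDiff ℝ 1 ψ)
    (pψ : IsPeriodic ψ) :
    ∫ y, ∑ i, bBar A b i y * pderiv i ψ y ∂(torusMeasure d) = 0 := by
  have hB := contDiff_bBar hA hb
  rw [← integral_sum_pderiv_eq_zero (fun i => (hB i).mul hψ) fun i y k j => by
    simp only [isPeriodic_bBar pA pb i y k j, pψ y k j]]
  refine integral_congr_ae ?_
  filter_upwards [cTilde_ae_eq_zero hA hb pA pb hc] with y hy
  simp_rw [fun i => pderiv_mul i ((hB i).differentiable (by simp) y)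
    (hψ.differentiable (by simp) y)]
  rw [Finset.sum_add_distrib, ← Finset.mul_sum, sum_pderiv_bBar hA hb, hy]
  simp

end Coefficients

/-! ### Bilinear forms on `L²` and `H¹` -/

lemma memLp_top_of_continuous {m : (Fin d → ℝ) → ℝ} (hm : Continuous m) :
    MemLp m ⊤ (torusMeasure d) := by
  obtain ⟨C, hC⟩ := isCompact_cube.exists_bound_of_continuousOn hm.continuousOn
  refine memLp_top_of_bound hm.aestronglyMeasurable C ?_
  filter_upwards [ae_restrict_mem isCompact_cube.measurableSet] with y hy using hC y hy

lemma integrable_mul_mul {m : (Fin d → ℝ) → ℝ} (hm : Continuous m) (u v : L2Torus d) :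
    Integrable (fun y => m y * u y * v y) (torusMeasure d) :=
  ((Lp.memLp u).mul' (r := 2) (memLp_top_of_continuous hm)).integrable_mul (Lp.memLp v)

/-- The bounded bilinear form `(u, v) ↦ ∫ m u v` on `L²(𝕋^d)` with a bounded weight `m`. -/
def mulForm (m : (Fin d → ℝ) → ℝ) (hm : MemLp m ⊤ (torusMeasure d)) :
    L2Torus d →L[ℝ] L2Torus d →L[ℝ] ℝ :=
  (ContinuousLinearMap.mul ℝ ℝ).lpPairing (torusMeasure d) 2 2 ∘L
    (ContinuousLinearMap.mul ℝ ℝ).holderL (torusMeasure d) ⊤ 2 2 hm.toLp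

lemma mulForm_apply (m : (Fin d → ℝ) → ℝ) (hm : MemLp m ⊤ (torusMeasure d)) (u v : L2Torus d) :
    mulForm m hm u v = ∫ y, m y * u y * v y ∂(torusMeasure d) := by
  simp only [mulForm, ContinuousLinearMap.comp_apply, ContinuousLinearMap.lpPairing_eq_integral,
    ContinuousLinearMap.holderL_apply_apply]
  refine integral_congr_ae ?_
  filter_upwards [(ContinuousLinearMap.mul ℝ ℝ).coeFn_holder (r := 2) hm.toLp u,
    hm.coeFn_toLp] with y h1 h2
  simp [h1, h2]

/-- The mean value as a continuous functional on `L²(𝕋^d)`. -/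
def meanL (d : ℕ) : L2Torus d →L[ℝ] ℝ := innerSL ℝ (Lp.const 2 (torusMeasure d) (1 : ℝ))

lemma meanL_apply (u : L2Torus d) : meanL d u = ∫ y, u y ∂(torusMeasure d) := by
  rw [meanL, innerSL_apply_apply, L2.inner_def]
  refine integral_congr_ae ?_
  filter_upwards [Lp.coeFn_const 2 (torusMeasure d) (1 : ℝ)] with y hy
  simp

lemma inner_eq_integral (u v : L2Torus d) :
    inner ℝ u v = ∫ y, u y * v y ∂(torusMeasure d) := by
  rw [L2.inner_def]
  exact integral_congr_ae (.of_forall fun y => by simp [mul_comm])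

lemma norm_sq_eq_integral (u : L2Torus d) : ‖u‖ ^ 2 = ∫ y, u y ^ 2 ∂(torusMeasure d) := by
  rw [← real_inner_self_eq_norm_sq, inner_eq_integral]
  simp_rw [sq]

/-- The embedding `H¹(𝕋^d) → L²(𝕋^d)` as a continuous linear map. -/
def toFunL (d : ℕ) : H1Torus d →L[ℝ] L2Torus d :=
  WithLp.fstL 2 ℝ _ _ ∘L (H1Torus d).subtypeL

/-- The weak partial derivative `∂_{y_i} : H¹(𝕋^d) → L²(𝕋^d)` as a continuous linear map. -/
def gradL (i : Fin d) : H1Torus d →L[ℝ] L2Torus d :=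
  PiLp.proj 2 (fun _ => L2Torus d) i ∘L WithLp.sndL 2 ℝ _ _ ∘L (H1Torus d).subtypeL

@[simp] lemma toFunL_apply (u : H1Torus d) : toFunL d u = toFun u := rfl

@[simp] lemma gradL_apply (i : Fin d) (u : H1Torus d) : gradL i u = grad u i := rfl

lemma norm_sq_H1 (u : H1Torus d) : ‖u‖ ^ 2 = ‖toFun u‖ ^ 2 + ∑ i, ‖grad u i‖ ^ 2 := by
  rw [Submodule.coe_norm, WithLp.prod_norm_sq_eq_of_L2, PiLp.norm_sq_eq_of_L2]
  rfl

/-- A closed property that holds for all smooth periodic functions holds on `H¹(𝕋^d)`. -/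
theorem H1Torus_induction {P : H1Torus d → Prop} (hP : IsClosed {u | P u})
    (smooth : ∀ (u : H1Torus d) (φ : (Fin d → ℝ) → ℝ), ContDiff ℝ ∞ φ → IsPeriodic φ →
      toFun u =ᵐ[torusMeasure d] φ → (∀ i, grad u i =ᵐ[torusMeasure d] pderiv i φ) → P u)
    (u : H1Torus d) : P u := by
  obtain ⟨s, hs, hlim⟩ := mem_closure_iff_seq_limit.1 (show (u : L2Jet d) ∈
    closure (smoothJets d : Set (L2Jet d)) from u.2)
  have hlim' : Filter.Tendsto (fun n => (⟨s n, subset_closure (hs n)⟩ : H1Torus d))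
      Filter.atTop (nhds u) := tendsto_subtype_rng.2 hlim
  refine hP.mem_of_tendsto hlim' (.of_forall fun n => ?_)
  obtain ⟨φ, hφ, pφ, h1, h2⟩ := hs n
  exact smooth _ φ hφ pφ h1 h2

/-- The constant function `1` belongs to `H¹(𝕋^d)`. -/
lemma exists_toFun_ae_eq_one (d : ℕ) : ∃ e : H1Torus d,
    toFun e =ᵐ[torusMeasure d] 1 ∧ ∀ i, grad e i = 0 := by
  refine ⟨⟨WithLp.toLp 2 (Lp.const 2 (torusMeasure d) (1 : ℝ), 0), subset_closure
    ⟨fun _ => 1, contDiff_const, fun _ _ _ => rfl, Lp.coeFn_const _ _ _, fun i => ?_⟩⟩,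
    Lp.coeFn_const _ _ _, fun i => rfl⟩
  have h : pderiv i (fun _ : Fin d → ℝ => (1 : ℝ)) = 0 := by
    funext y; simp [pderiv]
  rw [h]
  exact Lp.coeFn_zero _ _ _

/-- The Poincaré inequality on `H¹(𝕋^d)`. -/
theorem norm_sq_toFun_le (u : H1Torus d) :
    ‖toFun u‖ ^ 2 ≤ (∫ y, toFun u y ∂(torusMeasure d)) ^ 2 + d / 2 * ∑ i, ‖grad u i‖ ^ 2 := by
  simp_rw [← meanL_apply, ← toFunL_apply, ← gradL_apply]
  refine H1Torus_induction (P := fun u => ‖toFunL d u‖ ^ 2 ≤ (meanL d (toFunL d u)) ^ 2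
    + d / 2 * ∑ i, ‖gradL i u‖ ^ 2) (isClosed_le (by fun_prop) (by fun_prop)) ?_ u
  intro u φ hφ pφ h1 h2
  have hp : ∀ i, Continuous (pderiv i φ) := continuous_pderiv (hφ.of_le (by simp))
  have e1 : ‖toFun u‖ ^ 2 = ∫ y, φ y ^ 2 ∂(torusMeasure d) := by
    rw [norm_sq_eq_integral]
    exact integral_congr_ae (h1.pow_const 2)
  have e2 : ∀ i, ‖grad u i‖ ^ 2 = ∫ y, pderiv i φ y ^ 2 ∂(torusMeasure d) := fun i => by
    rw [norm_sq_eq_integral]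
    exact integral_congr_ae ((h2 i).pow_const 2)
  simp only [toFunL_apply, gradL_apply, meanL_apply, e1, e2, integral_congr_ae h1]
  rw [← integral_finsetSum (f := fun i y => pderiv i φ y ^ 2) _
    fun i _ => integrable_torus ((hp i).pow 2)]
  exact integral_sq_le_of_contDiff (contDiff_infty.1 hφ 2) pφ

lemma integrable_diffusion {a : Fin d → Fin d → (Fin d → ℝ) → ℝ} (ha : ∀ i j, Continuous (a i j))
    (u v : H1Torus d) : Integrable (fun y => 1 / 2 * ∑ i, ∑ j, a i j y * grad u j y * grad v i y)
      (torusMeasure d) :=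
  (integrable_finsetSum _ fun i _ => integrable_finsetSum _ fun j _ =>
    integrable_mul_mul (ha i j) _ _).const_mul _

lemma integrable_drift {β : Fin d → (Fin d → ℝ) → ℝ} (hβ : ∀ i, Continuous (β i))
    (u v : H1Torus d) : Integrable (fun y => (∑ i, β i y * grad u i y) * toFun v y)
      (torusMeasure d) := by
  simp_rw [Finset.sum_mul]
  exact integrable_finsetSum _ fun i _ => integrable_mul_mul (hβ i) _ _

lemma exists_diffusion_form {a : Fin d → Fin d → (Fin d → ℝ) → ℝ}
    (ha : ∀ i j, Continuous (a i j)) : ∃ B : H1Torus d →L[ℝ] H1Torus d →L[ℝ] ℝ, ∀ u v,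
      B u v = ∫ y, 1 / 2 * ∑ i, ∑ j, a i j y * grad u j y * grad v i y ∂(torusMeasure d) := by
  refine ⟨(1 / 2 : ℝ) • ∑ i, ∑ j, (mulForm (a i j)
    (memLp_top_of_continuous (ha i j))).bilinearComp (gradL j) (gradL i), fun u v => ?_⟩
  rw [integral_const_mul, integral_finsetSum _ fun i _ => integrable_finsetSum _ fun j _ =>
    integrable_mul_mul (ha i j) _ _]
  simp_rw [fun i => integral_finsetSum (μ := torusMeasure d) Finset.univ
    fun j _ => integrable_mul_mul (ha i j) (grad u j) (grad v i)]
  simp [mulForm_apply]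

lemma exists_drift_form {β : Fin d → (Fin d → ℝ) → ℝ} (hβ : ∀ i, Continuous (β i)) :
    ∃ B : H1Torus d →L[ℝ] H1Torus d →L[ℝ] ℝ, ∀ u v,
      B u v = ∫ y, (∑ i, β i y * grad u i y) * toFun v y ∂(torusMeasure d) := by
  refine ⟨∑ i, (mulForm (β i) (memLp_top_of_continuous (hβ i))).bilinearComp (gradL i)
    (toFunL d), fun u v => ?_⟩
  simp_rw [Finset.sum_mul]
  rw [integral_finsetSum _ fun i _ => integrable_mul_mul (hβ i) _ _]
  simp [mulForm_apply]

/-! ### The bilinear form of the operator -/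

section Operator

variable {A : (Fin d → ℝ) → Matrix (Fin d) (Fin d) ℝ} {b : (Fin d → ℝ) → Fin d → ℝ}

lemma bilinForm_eq_add (hA : ∀ i j, ContDiff ℝ 2 fun y => A y i j)
    (hb : ∀ i, ContDiff ℝ 2 fun y => b y i) (hc : cTilde A b =ᵐ[torusMeasure d] 0)
    (u v : H1Torus d) :
    bilinForm A b u v
      = ∫ y, 1 / 2 * ∑ i, ∑ j, A y i j * grad u j y * grad v i y ∂(torusMeasure d)
        + ∫ y, (∑ i, bBar A b i y * grad u i y) * toFun v y ∂(torusMeasure d) := by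
  rw [← integral_add (integrable_diffusion (a := fun i j y => A y i j)
    (fun i j => (hA i j).continuous) u v)
    (integrable_drift (fun i => (contDiff_bBar hA hb i).continuous) u v)]
  refine integral_congr_ae ?_
  filter_upwards [hc] with y hy
  simp [hy]

lemma exists_bilinForm_eq (hA : ∀ i j, ContDiff ℝ 2 fun y => A y i j)
    (hb : ∀ i, ContDiff ℝ 2 fun y => b y i) (hc : cTilde A b =ᵐ[torusMeasure d] 0) :
    ∃ B : H1Torus d →L[ℝ] H1Torus d →L[ℝ] ℝ, ∀ u v, B u v = bilinForm A b u v := by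
  obtain ⟨B₁, h₁⟩ := exists_diffusion_form (a := fun i j y => A y i j)
    fun i j => (hA i j).continuous
  obtain ⟨B₂, h₂⟩ := exists_drift_form fun i => (contDiff_bBar hA hb i).continuous
  refine ⟨B₁ + B₂, fun u v => ?_⟩
  rw [bilinForm_eq_add hA hb hc, ← h₁, ← h₂]
  rfl

/-- The drift term is skew: it vanishes on the diagonal because `⟨b̄, ∇u⟩ u = ⟨b̄, ∇(u²/2)⟩` and
`b̄` is divergence-free. -/
theorem integral_drift_self (hA : ∀ i j, ContDiff ℝ 2 fun y => A y i j)
    (hb : ∀ i, ContDiff ℝ 2 fun y => b y i) (pA : IsPeriodic A) (pb : IsPeriodic b)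
    (hc : ∀ y, cTilde A b y ≤ 0) (u : H1Torus d) :
    ∫ y, (∑ i, bBar A b i y * grad u i y) * toFun u y ∂(torusMeasure d) = 0 := by
  obtain ⟨B, hB⟩ := exists_drift_form fun i => (contDiff_bBar hA hb i).continuous
  rw [← hB]
  refine H1Torus_induction (P := fun u => B u u = 0)
    (isClosed_eq (by fun_prop) continuous_const) ?_ u
  intro u φ hφ pφ h1 h2
  have hφ1 : ContDiff ℝ 1 φ := hφ.of_le (by simp)
  have h0 := integral_sum_bBar_mul_pderiv hA hb pA pb hc (contDiff_const.mul (hφ1.mul hφ1))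
    (ψ := fun y => 1 / 2 * (φ y * φ y)) fun y k i => by simp only [pφ y k i]
  rw [hB, ← h0]
  refine integral_congr_ae ?_
  filter_upwards [h1, ae_all_iff.2 h2] with y hy1 hy2
  have hd : DifferentiableAt ℝ φ y := hφ1.differentiable (by simp) y
  rw [Finset.sum_mul]
  refine Finset.sum_congr rfl fun i _ => ?_
  rw [hy1, hy2, pderiv_const_mul i _ (hd.fun_mul hd), pderiv_mul i hd hd]
  ring

/-- Constants solve the adjoint equation. -/
theorem bilinForm_eq_zero_of_const (hA : ∀ i j, ContDiff ℝ 2 fun y => A y i j)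
    (hb : ∀ i, ContDiff ℝ 2 fun y => b y i) (pA : IsPeriodic A) (pb : IsPeriodic b)
    (hc : ∀ y, cTilde A b y ≤ 0) {e : H1Torus d} (he : toFun e =ᵐ[torusMeasure d] 1)
    (he' : ∀ i, grad e i = 0) (u : H1Torus d) : bilinForm A b u e = 0 := by
  obtain ⟨B, hB⟩ := exists_bilinForm_eq hA hb (cTilde_ae_eq_zero hA hb pA pb hc)
  rw [← hB]
  refine H1Torus_induction (P := fun u => B u e = 0)
    (isClosed_eq (by fun_prop) continuous_const) ?_ u
  intro u φ hφ pφ h1 h2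
  rw [hB, bilinForm_eq_add hA hb (cTilde_ae_eq_zero hA hb pA pb hc)]
  have h0 := integral_sum_bBar_mul_pderiv hA hb pA pb hc (hφ.of_le (by simp)) pφ
  have e1 : ∫ y, 1 / 2 * ∑ i, ∑ j, A y i j * grad u j y * grad e i y ∂(torusMeasure d) = 0 := by
    simp [he']
  rw [e1, zero_add, ← h0]
  refine integral_congr_ae ?_
  filter_upwards [he, ae_all_iff.2 h2] with y hy1 hy2
  simp [hy1, hy2]

/-- Only the second-order term contributes to the energy, and it is bounded below by ellipticity. -/
theorem bilinForm_self_ge (hA : ∀ i j, ContDiff ℝ 2 fun y => A y i j)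
    (hb : ∀ i, ContDiff ℝ 2 fun y => b y i) (pA : IsPeriodic A) (pb : IsPeriodic b)
    (hc : ∀ y, cTilde A b y ≤ 0) {c₀ : ℝ}
    (hc₀ : ∀ y ξ : Fin d → ℝ, c₀ * ∑ i, ξ i ^ 2 ≤ ∑ i, ∑ j, ξ i * A y i j * ξ j)
    (u : H1Torus d) : c₀ / 2 * ∑ i, ‖grad u i‖ ^ 2 ≤ bilinForm A b u u := by
  rw [bilinForm_eq_add hA hb (cTilde_ae_eq_zero hA hb pA pb hc),
    integral_drift_self hA hb pA pb hc, add_zero]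
  have hi : ∀ i ∈ Finset.univ, Integrable (fun y => grad u i y ^ 2) (torusMeasure d) :=
    fun i _ => (Lp.memLp _).integrable_sq
  simp_rw [norm_sq_eq_integral]
  rw [← integral_finsetSum _ hi, ← integral_const_mul]
  refine integral_mono ((integrable_finsetSum _ hi).const_mul _) (integrable_diffusion
    (a := fun i j y => A y i j) (fun i j => (hA i j).continuous) u u) fun y => ?_
  have h := hc₀ y fun i => grad u i y
  have e : ∑ i, ∑ j, A y i j * grad u j y * grad u i y
      = ∑ i, ∑ j, grad u i y * A y i j * grad u j y :=
    Finset.sum_congr rfl fun i _ => Finset.sum_congr rfl fun j _ => by ring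
  simp only [e]
  linarith

/-- On functions of mean zero, ellipticity and the Poincaré inequality give coercivity. -/
theorem exists_pos_le_bilinForm_self (hA : ∀ i j, ContDiff ℝ 2 fun y => A y i j)
    (hb : ∀ i, ContDiff ℝ 2 fun y => b y i) (pA : IsPeriodic A) (pb : IsPeriodic b)
    (hc : ∀ y, cTilde A b y ≤ 0) (hell : IsUniformlyElliptic A) :
    ∃ C : ℝ, 0 < C ∧ ∀ u ∈ meanZeroH1 d, C * ‖u‖ ^ 2 ≤ bilinForm A b u u := by
  obtain ⟨c₀, hpos, hc₀⟩ := hell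
  refine ⟨c₀ / (d + 2), by positivity, fun u hu => ?_⟩
  have hP := norm_sq_toFun_le u
  rw [show ∫ y, toFun u y ∂(torusMeasure d) = 0 from hu] at hP
  refine le_trans ?_ (bilinForm_self_ge hA hb pA pb hc hc₀ u)
  rw [norm_sq_H1, div_mul_eq_mul_div, div_le_iff₀ (by positivity)]
  -- The claim reads `‖u‖² ≤ (d / 2) ‖∇u‖²` after cancelling `‖∇u‖²` and the factor `c₀`.
  nlinarith

end Operator

/-! ### Existence and uniqueness of weak solutions -/

/-- The existence part of the Lax-Milgram theorem on a subspace. -/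
theorem exists_mem_forall_apply_eq_of_coercive {H : Type*} [NormedAddCommGroup H]
    [InnerProductSpace ℝ H] (V : Submodule ℝ H) [CompleteSpace V] (B : H →L[ℝ] H →L[ℝ] ℝ)
    {C : ℝ} (hC : 0 < C) (hB : ∀ u ∈ V, C * ‖u‖ ^ 2 ≤ B u u) (F : H →L[ℝ] ℝ) :
    ∃ w ∈ V, ∀ v ∈ V, B w v = F v := by
  have hco : IsCoercive (B.bilinearComp V.subtypeL V.subtypeL) := by
    refine ⟨C, hC, fun u => ?_⟩
    rw [mul_assoc, ← sq]
    exact hB u u.2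
  refine ⟨hco.continuousLinearEquivOfBilin.symm
    ((InnerProductSpace.toDual ℝ V).symm (F ∘L V.subtypeL)), Subtype.property _, fun v hv => ?_⟩
  have h := hco.continuousLinearEquivOfBilin_apply (hco.continuousLinearEquivOfBilin.symm
    ((InnerProductSpace.toDual ℝ V).symm (F ∘L V.subtypeL))) ⟨v, hv⟩
  rw [ContinuousLinearEquiv.apply_symm_apply, InnerProductSpace.toDual_symm_apply] at h
  exact h.symm

end PeriodicElliptic

end

open PeriodicElliptic in
theorem mainTheorem6 (d : ℕ)
    (A : (Fin d → ℝ) → Matrix (Fin d) (Fin d) ℝ) (b : (Fin d → ℝ) → Fin d → ℝ)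
    (hA_per : PeriodicElliptic.IsPeriodic A) (hb_per : PeriodicElliptic.IsPeriodic b)
    (hA_smooth : ∀ i j, ContDiff ℝ 2 (fun y => A y i j))
    (hb_smooth : ∀ i, ContDiff ℝ 2 (fun y => b y i))
    (hA_ell : PeriodicElliptic.IsUniformlyElliptic A)
    (hc : ∀ y, PeriodicElliptic.cTilde A b y ≤ 0)
    (f : PeriodicElliptic.L2Torus d) (hf : f ∈ PeriodicElliptic.meanZeroL2 d) :
    ∃! w : PeriodicElliptic.H1Torus d,
      w ∈ PeriodicElliptic.meanZeroH1 d ∧ PeriodicElliptic.IsWeakSolution A b f w := by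
  have hc0 := cTilde_ae_eq_zero hA_smooth hb_smooth hA_per hb_per hc
  obtain ⟨B, hB⟩ := exists_bilinForm_eq hA_smooth hb_smooth hc0
  obtain ⟨C, hC, hcoer⟩ :=
    exists_pos_le_bilinForm_self hA_smooth hb_smooth hA_per hb_per hc hA_ell
  obtain ⟨e, he, he'⟩ := exists_toFun_ae_eq_one d
  have hBe : ∀ u, B u e = 0 := fun u => by
    rw [hB, bilinForm_eq_zero_of_const hA_smooth hb_smooth hA_per hb_per hc he he']
  let V : Submodule ℝ (H1Torus d) := (meanL d ∘L toFunL d).ker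
  have : CompleteSpace (H1Torus d) :=
    (Submodule.isClosed_topologicalClosure (smoothJets d)).completeSpace_coe
  have : CompleteSpace V := ContinuousLinearMap.completeSpace_ker (meanL d ∘L toFunL d)
  have mem_V : ∀ u, u ∈ V ↔ u ∈ meanZeroH1 d := fun u => by
    change meanL d (toFun u) = 0 ↔ ∫ y, toFun u y ∂(torusMeasure d) = 0
    rw [meanL_apply]
  let F : H1Torus d →L[ℝ] ℝ := innerSL ℝ f ∘L toFunL d
  have hF : ∀ v, F v = ∫ y, f y * toFun v y ∂(torusMeasure d) := fun v => inner_eq_integral f _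
  have hFe : F e = 0 := by
    rw [hF, ← show ∫ y, f y ∂(torusMeasure d) = 0 from hf]
    refine integral_congr_ae ?_
    filter_upwards [he] with y hy
    simp [hy]
  obtain ⟨w, hwV, hw⟩ := exists_mem_forall_apply_eq_of_coercive V B hC
    (fun u hu => (hcoer u ((mem_V u).1 hu)).trans_eq (hB u u).symm) F
  refine ⟨w, ⟨(mem_V _).1 hwV, fun v => ?_⟩, fun w' ⟨hw', hsol⟩ => ?_⟩
  · -- Split the test function into its mean and a mean-zero part.
    have hmem : v - meanL d (toFun v) • e ∈ V := by
      have h1 : meanL d (toFunL d e) = 1 := by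
        rw [meanL_apply, toFunL_apply, integral_congr_ae he]
        simp
      change meanL d (toFunL d (v - meanL d (toFun v) • e)) = 0
      rw [map_sub, map_sub, map_smul, map_smul, h1]
      simp
    have h := hw _ hmem
    simp only [map_sub, map_smul, hBe, hFe, smul_zero, sub_zero] at h
    rw [← hB, ← hF, h]
  · -- The difference of two solutions has zero energy.
    have hmem : w' - w ∈ V := V.sub_mem ((mem_V _).2 hw') hwV
    have h0 : B (w' - w) (w' - w) = 0 := by
      rw [map_sub B, sub_apply, hw _ hmem, hB, hsol, ← hF, sub_self]
    have h := hcoer _ ((mem_V _).1 hmem)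
    rw [← hB, h0] at h
    have : ‖w' - w‖ ^ 2 = 0 := le_antisymm (by nlinarith) (sq_nonneg _)
    simpa [sub_eq_zero] using this
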